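/- Let $n\ge 2$ be an integer, let $Q_n=\{r^2 : r\in\mathbb{Z}_n^*\}$ be the set of squares of units of the ring $\mathbb{Z}_n$ of integers modulo $n$, and let $\mathcal{G}_{\mathbb{Z}_n}=\operatorname{Cay}(\mathbb{Z}_n,\,Q_n\cup(-Q_n))$ be the quadratic unitary Cayley graph: its vertex set is $\mathbb{Z}_n$, and $u,v$ are adjacent if and only if $u-v\in Q_n\cup(-Q_n)$. For a finite simple graph $G$ with vertex set $V$, let $\mathcal{A}$ be the set of arcs of $G$, that is, the ordered pairs $a=(u,v)$ of adjacent vertices, with terminus $t(a)=v$ and inverse arc $a^{-1}=(v,u)$. Define $N\in\mathbb{C}^{V\times\mathcal{A}}$ by $N_{xa}=\frac{1}{\sqrt{\deg x}}$ if $x=t(a)$ and $N_{xa}=0$ otherwise, and define $R\in\mathbb{C}^{\mathcal{A}\times\mathcal{A}}$ by $R_{ab}=1$ if $a=b^{-1}$ and $R_{ab}=0$ otherwise. The time evolution matrix of the Grover walk on $G$ is $U=R(2N^*N-I)$, and $G$ is called periodic if $U^\tau=I$ for some positive integer $\tau$. Then $\mathcal{G}_{\mathbb{Z}_n}$ is periodic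 if and only if at least one of the following holds: 1. $n=2^\alpha 3^\beta$ for some non-negative integers $\alpha,\beta$ with $\alpha+\beta\neq 0$; 2. $n=2^\delta 5^\gamma$ for some integers $\gamma\ge 1$ and $0\le\delta\le 2$. -/

import Mathlib

namespace GroverWalk

open Matrix

section Walk

variable {V : Type*} [Fintype V] [DecidableEq V] (G : SimpleGraph V) [DecidableRel G.Adj]

/-- The boundary matrix, `N x a = δ_{x, t(a)} / √(deg x)`. The symmetric arcs of `G` are its darts:
`a.fst` is the origin, `a.snd` the terminus and `a.symm` the inverse arc of `a`. -/
noncomputable def boundaryMatrix : Matrix V G.Dart ℂ :=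
  Matrix.of fun x a => if x = a.snd then 1 / (Real.sqrt (G.degree x) : ℂ) else 0

/-- The coin matrix `C = 2 N* N - I`. -/
noncomputable def coinMatrix : Matrix G.Dart G.Dart ℂ :=
  (2 : ℂ) • ((boundaryMatrix G)ᴴ * boundaryMatrix G) - 1

/-- The shift matrix, `R a b = δ_{a, b⁻¹}`. -/
def shiftMatrix : Matrix G.Dart G.Dart ℂ :=
  Matrix.of fun a b => if a = b.symm then 1 else 0

/-- The time evolution matrix `U = R C` of the Grover walk on `G`. -/
noncomputable def timeEvolution : Matrix G.Dart G.Dart ℂ :=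
  shiftMatrix G * coinMatrix G

/-- `G` is periodic if `U ^ τ = I` for some positive integer `τ`. -/
def IsPeriodic : Prop :=
  ∃ τ : ℕ, 0 < τ ∧ timeEvolution G ^ τ = 1

end Walk

/-- The set `Q_n` of squares of units of `ℤ/nℤ`. -/
def unitSquares (n : ℕ) : Set (ZMod n) :=
  {x | ∃ r : (ZMod n)ˣ, x = (r : ZMod n) ^ 2}

/-- The quadratic unitary Cayley graph `Cay(ℤ/nℤ, Q_n ∪ -Q_n)`. -/
def quadraticUnitaryCayleyGraph (n : ℕ) : SimpleGraph (ZMod n) :=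
  SimpleGraph.circulantGraph (unitSquares n ∪ {x | -x ∈ unitSquares n})

end GroverWalk

/-! On a `k`-regular graph, an eigenvector `f` of the adjacency matrix with eigenvalue `μ` lifts to
`w = N* f` with `U² w = (2μ/k) U w - w`, so the walk has eigenvalues `z`, `z⁻¹` with `z + z⁻¹ =
2μ/k`. Periodicity makes `z` a root of unity, hence `2μ/k` an algebraic integer
(`IsPeriodic.isIntegral`). Conversely, if a spanning family of eigenvectors has such `z` of bounded
order, unitarity of `U` gives periodicity (`isPeriodic_of_span`).

For the Cayley graph the eigenvectors are the additive characters, and `μ/k` is the average of the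
character over the connection set `S`, a subgroup of the units. These averages do not change when a
character modulo `m ∣ n` is inflated to `n`, so non-integrality modulo `m` excludes every multiple
of `m` (`isIntegral_average`). Combining conjugate averages into a non-integral rational excludes `m
= 15`, `m = 40` and all primes `p ≥ 7`; only the listed `n` survive.

For those `n`, `S` lies in `±1 + H` and is a union of cosets of `H = dℤ_n`, with `d = 24` or `d =
10` (`isPeriodic_of_one_add_mem`). Characters trivial on `H` then give `2μ/k = χ(1) + χ(1)⁻¹`, and
all others give `0 = i + i⁻¹`. -/

namespace GroverWalk

open Matrix

/-! ### Spectral criteria for periodicity on regular graphs. -/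

section Walk

variable {V : Type*} [Fintype V] [DecidableEq V] {G : SimpleGraph V} [DecidableRel G.Adj]

theorem shiftMatrix_mul_apply {ι : Type*} (M : Matrix G.Dart ι ℂ) (a : G.Dart) (i : ι) :
    (shiftMatrix G * M) a i = M a.symm i := by
  rw [Matrix.mul_apply, Finset.sum_eq_single a.symm]
  · simp [shiftMatrix]
  · intro b _ hb
    have : a ≠ b.symm := fun h => hb (by rw [h, SimpleGraph.Dart.symm_symm])
    simp [shiftMatrix, this]
  · simp

theorem shiftMatrix_mul_self : shiftMatrix G * shiftMatrix G = 1 := by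
  ext a b
  rw [shiftMatrix_mul_apply]
  simp only [shiftMatrix, Matrix.of_apply, Matrix.one_apply]
  congr 1
  exact propext ⟨fun h => SimpleGraph.Dart.symm_involutive.injective h, fun h => by rw [h]⟩

omit [Fintype V] [DecidableRel G.Adj] in
theorem shiftMatrix_conjTranspose : (shiftMatrix G)ᴴ = shiftMatrix G := by
  ext a b
  have : b = a.symm ↔ a = b.symm :=
    ⟨fun h => by rw [h, SimpleGraph.Dart.symm_symm], fun h => by rw [h, SimpleGraph.Dart.symm_symm]⟩
  simp only [shiftMatrix, Matrix.conjTranspose_apply, Matrix.of_apply, this]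
  split_ifs <;> simp

theorem sum_dart_ite_snd (x : V) (F : V → ℂ) :
    ∑ a : G.Dart, (if x = a.snd then F a.fst else 0) = ∑ y ∈ G.neighborFinset x, F y := by
  rw [← Finset.sum_filter]
  refine Finset.sum_bij (fun a _ => a.fst) ?_ ?_ ?_ ?_
  · intro a ha
    simp only [Finset.mem_filter, Finset.mem_univ, true_and] at ha
    rw [SimpleGraph.mem_neighborFinset, ha]
    exact a.adj.symm
  · intro a ha b hb h
    simp only [Finset.mem_filter, Finset.mem_univ, true_and] at ha hb
    exact SimpleGraph.Dart.ext _ _ (Prod.ext h (ha.symm.trans hb))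
  · intro y hy
    rw [SimpleGraph.mem_neighborFinset] at hy
    exact ⟨⟨(y, x), hy.symm⟩, by simp, rfl⟩
  · simp

theorem boundaryMatrix_mul_conjTranspose (hG : ∀ x, 0 < G.degree x) :
    boundaryMatrix G * (boundaryMatrix G)ᴴ = 1 := by
  ext x y
  have key : ∀ a : G.Dart, boundaryMatrix G x a * (boundaryMatrix G)ᴴ a y =
      if x = a.snd then (if x = y then (1 / (G.degree x : ℂ)) else 0) else 0 := by
    intro a
    simp only [boundaryMatrix, Matrix.conjTranspose_apply, Matrix.of_apply]
    by_cases h : x = a.snd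
    · by_cases h' : x = y
      · subst h'
        have : ((Real.sqrt (G.degree x) : ℝ) : ℂ) * (Real.sqrt (G.degree x) : ℝ) =
            G.degree x := by
          rw [← Complex.ofReal_mul, Real.mul_self_sqrt (Nat.cast_nonneg _)]; simp
        simp only [if_pos h, if_true, one_div, star_inv₀, RCLike.star_def, Complex.conj_ofReal]
        rw [← this, mul_inv]
      · have : y ≠ a.snd := fun h2 => h' (h.trans h2.symm)
        simp [h', this]
    · simp [h]
  rw [Matrix.mul_apply, Finset.sum_congr rfl fun a _ => key a,
    sum_dart_ite_snd x fun _ => if x = y then (1 / (G.degree x : ℂ)) else 0]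
  have h0 : (G.degree x : ℂ) ≠ 0 := by exact_mod_cast (hG x).ne'
  by_cases h : x = y <;> simp [h, Matrix.one_apply]
  subst h
  exact mul_inv_cancel₀ h0

theorem boundaryMatrix_shiftMatrix_conjTranspose {k : ℕ} (hG : ∀ x, G.degree x = k) :
    boundaryMatrix G * (shiftMatrix G * (boundaryMatrix G)ᴴ) = (k : ℂ)⁻¹ • G.adjMatrix ℂ := by
  ext x y
  have key : ∀ a : G.Dart, boundaryMatrix G x a * (shiftMatrix G * (boundaryMatrix G)ᴴ) a y =
      if x = a.snd then (if y = a.fst then (k : ℂ)⁻¹ else 0) else 0 := by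
    intro a
    have : ((Real.sqrt k : ℝ) : ℂ) * (Real.sqrt k : ℝ) = k := by
      rw [← Complex.ofReal_mul, Real.mul_self_sqrt (Nat.cast_nonneg _)]; simp
    rw [shiftMatrix_mul_apply]
    simp only [boundaryMatrix, Matrix.conjTranspose_apply, Matrix.of_apply, hG]
    by_cases h : x = a.snd <;> by_cases h' : y = a.fst <;> simp [h, h']
    rw [← mul_inv, this]
  rw [Matrix.mul_apply, Finset.sum_congr rfl fun a _ => key a,
    sum_dart_ite_snd x fun z => if y = z then (k : ℂ)⁻¹ else 0]
  simp [SimpleGraph.adjMatrix_apply]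

theorem timeEvolution_eq : timeEvolution G =
    shiftMatrix G * ((2 : ℂ) • ((boundaryMatrix G)ᴴ * boundaryMatrix G) - 1) := rfl

theorem timeEvolution_mul_boundary (hG : ∀ x, 0 < G.degree x) :
    timeEvolution G * (boundaryMatrix G)ᴴ = shiftMatrix G * (boundaryMatrix G)ᴴ := by
  rw [timeEvolution_eq, Matrix.mul_assoc, Matrix.sub_mul, Matrix.smul_mul, Matrix.mul_assoc,
    boundaryMatrix_mul_conjTranspose hG, Matrix.mul_one, Matrix.one_mul, two_smul,
    add_sub_cancel_right]

/-- Together with `timeEvolution_mul_boundary`, this makes the span of `N* f` and `R N* f` invariant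
under `U` whenever `f` is an adjacency eigenvector. -/
theorem timeEvolution_mul_shift_boundary {k : ℕ} (hG : ∀ x, G.degree x = k) :
    timeEvolution G * (shiftMatrix G * (boundaryMatrix G)ᴴ) =
      (2 / k : ℂ) • (shiftMatrix G * (boundaryMatrix G)ᴴ * G.adjMatrix ℂ) -
        (boundaryMatrix G)ᴴ := by
  rw [timeEvolution_eq, Matrix.mul_assoc, Matrix.sub_mul, Matrix.smul_mul, Matrix.mul_assoc,
    boundaryMatrix_shiftMatrix_conjTranspose hG, Matrix.mul_sub, Matrix.one_mul,
    ← Matrix.mul_assoc (shiftMatrix G) (shiftMatrix G), shiftMatrix_mul_self, Matrix.one_mul,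
    Matrix.mul_smul, Matrix.mul_smul, Matrix.mul_smul, smul_smul, Matrix.mul_assoc, div_eq_mul_inv]

/-- `N* N` is an orthogonal projection because `N N* = 1`, so the coin is a reflection; the shift is
a Hermitian involution as well. -/
theorem timeEvolution_mem_unitary (hG : ∀ x, 0 < G.degree x) :
    (timeEvolution G)ᴴ * timeEvolution G = 1 := by
  have hP : (boundaryMatrix G)ᴴ * boundaryMatrix G * ((boundaryMatrix G)ᴴ * boundaryMatrix G) =
      (boundaryMatrix G)ᴴ * boundaryMatrix G := by
    rw [Matrix.mul_assoc, ← Matrix.mul_assoc (boundaryMatrix G),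
      boundaryMatrix_mul_conjTranspose hG, Matrix.one_mul]
  have hP' : ((boundaryMatrix G)ᴴ * boundaryMatrix G)ᴴ = (boundaryMatrix G)ᴴ * boundaryMatrix G := by
    simp
  rw [timeEvolution_eq]
  generalize (boundaryMatrix G)ᴴ * boundaryMatrix G = P at *
  have hC : ((2 : ℂ) • P - 1)ᴴ = (2 : ℂ) • P - 1 := by simp [hP']
  rw [Matrix.conjTranspose_mul, hC, shiftMatrix_conjTranspose, Matrix.mul_assoc,
    ← Matrix.mul_assoc (shiftMatrix G), shiftMatrix_mul_self, Matrix.one_mul]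
  simp only [two_smul, sub_mul, mul_sub, add_mul, mul_add, hP, one_mul, mul_one]
  abel

/-- The quadratic relation satisfied by the time evolution on the lift of an eigenvector. -/
theorem timeEvolution_quadratic {k : ℕ} (hk : 0 < k) (hG : ∀ x, G.degree x = k) {f : V → ℂ} {μ : ℂ}
    (hf : G.adjMatrix ℂ *ᵥ f = μ • f) :
    (timeEvolution G * timeEvolution G) *ᵥ ((boundaryMatrix G)ᴴ *ᵥ f) =
      (2 * μ / k) • (timeEvolution G *ᵥ ((boundaryMatrix G)ᴴ *ᵥ f)) -
        (boundaryMatrix G)ᴴ *ᵥ f := by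
  have hG' : ∀ x, 0 < G.degree x := fun x => by rw [hG]; exact hk
  rw [Matrix.mulVec_mulVec, Matrix.mulVec_mulVec, Matrix.mul_assoc, timeEvolution_mul_boundary hG',
    timeEvolution_mul_shift_boundary hG, Matrix.sub_mulVec, Matrix.smul_mulVec, ← Matrix.mulVec_mulVec,
    hf, Matrix.mulVec_smul, smul_smul]
  congr 2
  ring

theorem exists_add_inv_eq (c : ℂ) : ∃ z : ℂ, z ≠ 0 ∧ c = z + z⁻¹ := by
  obtain ⟨s, hs⟩ := IsAlgClosed.exists_pow_nat_eq (c ^ 2 - 4) two_pos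
  have h : (c + s) / 2 * ((c - s) / 2) = 1 := by linear_combination -hs / 4
  refine ⟨(c + s) / 2, left_ne_zero_of_mul_eq_one h, ?_⟩
  rw [← eq_inv_of_mul_eq_one_right h]
  ring

theorem pow_mulVec_eq {ι : Type*} [Fintype ι] [DecidableEq ι] {U : Matrix ι ι ℂ} {v : ι → ℂ} {z : ℂ}
    (h : U *ᵥ v = z • v) (t : ℕ) : (U ^ t) *ᵥ v = z ^ t • v := by
  induction t with
  | zero => simp
  | succ t ih =>
    rw [pow_succ, ← Matrix.mulVec_mulVec, h, Matrix.mulVec_smul, ih, smul_smul, pow_succ, mul_comm]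

/-- Eigenvalues of the transition matrix of a periodic regular graph are half-integral. -/
theorem IsPeriodic.isIntegral (hper : IsPeriodic G) {k : ℕ} (hk : 0 < k)
    (hG : ∀ x, G.degree x = k) {f : V → ℂ} {μ : ℂ} (hf0 : f ≠ 0)
    (hf : G.adjMatrix ℂ *ᵥ f = μ • f) : IsIntegral ℤ (2 * μ / k) := by
  obtain ⟨t, ht, hU⟩ := hper
  have hG' : ∀ x, 0 < G.degree x := fun x => by rw [hG]; exact hk
  have hq := timeEvolution_quadratic hk hG hf
  have hw : (boundaryMatrix G)ᴴ *ᵥ f ≠ 0 := by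
    intro h
    apply hf0
    rw [← Matrix.one_mulVec f, ← boundaryMatrix_mul_conjTranspose hG', ← Matrix.mulVec_mulVec, h,
      Matrix.mulVec_zero]
  obtain ⟨z, hz, hc⟩ := exists_add_inv_eq (2 * μ / k)
  rw [hc] at hq ⊢
  generalize (boundaryMatrix G)ᴴ *ᵥ f = w at hq hw
  generalize timeEvolution G = U at hq hU
  have hroot : ∀ {y : ℂ} {v : G.Dart → ℂ}, v ≠ 0 → U *ᵥ v = y • v → y ^ t = 1 := by
    intro y v hv h
    have := pow_mulVec_eq h t
    rw [hU, Matrix.one_mulVec] at this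
    by_contra hne
    apply hv
    have h2 : (y ^ t - 1) • v = 0 := by rw [sub_smul, one_smul, ← this, sub_self]
    exact (smul_eq_zero.mp h2).resolve_left (sub_ne_zero.mpr hne)
  -- The relation reads `(U - z)(U - z⁻¹) w = 0`: either `w` is an eigenvector for `z⁻¹`, or `(U -
  -- z⁻¹) w` is one for `z`.
  have hzt : z ^ t = 1 := by
    by_cases hv : U *ᵥ w - z⁻¹ • w = 0
    · have := hroot hw (sub_eq_zero.mp hv)
      rwa [inv_pow, inv_eq_one] at this
    · refine hroot hv ?_
      rw [Matrix.mulVec_sub, Matrix.mulVec_smul, Matrix.mulVec_mulVec, hq, smul_sub, smul_smul,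
        mul_inv_cancel₀ hz, add_smul, one_smul]
      abel
  have hint : ∀ {y : ℂ}, y ^ t = 1 → IsIntegral ℤ y := fun h =>
    IsIntegral.of_pow ht (by rw [h]; exact isIntegral_one)
  exact (hint hzt).add (hint (by rw [inv_pow, hzt, inv_one]))

open scoped ComplexOrder in
-- Normality gives `(B* B)⁴ = 0`, and a Hermitian matrix with zero square vanishes; this is used
-- twice on powers of `B* B`, then `B* B = 0` forces `B = 0`.
theorem eq_zero_of_normal_of_pow_four {ι : Type*} [Fintype ι] [DecidableEq ι] {B : Matrix ι ι ℂ}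
    (hB : Commute Bᴴ B) (h4 : B ^ 4 = 0) : B = 0 := by
  have hherm : ∀ C : Matrix ι ι ℂ, Cᴴ = C → C * C = 0 → C = 0 := by
    intro C hC h
    rw [← Matrix.conjTranspose_mul_self_eq_zero, hC, h]
  have hH : (Bᴴ * B)ᴴ = Bᴴ * B := by simp
  have hH4 : (Bᴴ * B) ^ 4 = 0 := by rw [hB.mul_pow, h4, mul_zero]
  have h2 : (Bᴴ * B) * (Bᴴ * B) = 0 := by
    apply hherm
    · rw [Matrix.conjTranspose_mul, hH]
    · rw [← hH4]; noncomm_ring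
  exact Matrix.conjTranspose_mul_self_eq_zero.mp (hherm _ hH h2)

/-- A regular graph is periodic as soon as the eigenvectors whose eigenvalues are `k cos θ`, with
`θ` a rational angle of bounded denominator, span all functions on the vertices. -/
theorem isPeriodic_of_span {k : ℕ} (hk : 0 < k) (hG : ∀ x, G.degree x = k) {t : ℕ} (ht : 0 < t)
    {J : Type*} (f : J → V → ℂ) (hspan : Submodule.span ℂ (Set.range f) = ⊤)
    (hf : ∀ j, ∃ μ z : ℂ, G.adjMatrix ℂ *ᵥ f j = μ • f j ∧ z ^ t = 1 ∧ 2 * μ / k = z + z⁻¹) :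
    IsPeriodic G := by
  have hG' : ∀ x, 0 < G.degree x := fun x => by rw [hG]; exact hk
  have hUU := timeEvolution_mem_unitary hG'
  have hUN := timeEvolution_mul_boundary hG'
  set U := timeEvolution G with hUdef
  set N := boundaryMatrix G
  -- The square covers `z = z⁻¹`: each of the two linear factors of the quadratic relation consumes
  -- one copy of `U ^ t - 1`.
  have hvec : ∀ g : V → ℂ, ((U ^ t - 1) ^ 2) *ᵥ (Nᴴ *ᵥ g) = 0 := by
    intro g
    have hg : g ∈ Submodule.span ℂ (Set.range f) := by rw [hspan]; trivial
    induction hg using Submodule.span_induction with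
    | mem x hx =>
      obtain ⟨j, rfl⟩ := hx
      obtain ⟨μ, z, hμ, hz, hc⟩ := hf j
      have hz0 : z ≠ 0 := by
        rintro rfl
        rw [zero_pow ht.ne'] at hz
        exact zero_ne_one hz
      have hq := timeEvolution_quadratic hk hG hμ
      rw [hc, ← hUdef] at hq
      have hv : (U - z • 1) *ᵥ ((U - z⁻¹ • 1) *ᵥ (Nᴴ *ᵥ f j)) = 0 := by
        rw [Matrix.mulVec_mulVec]
        have : (U - z • (1 : Matrix G.Dart G.Dart ℂ)) * (U - z⁻¹ • 1) =
            U * U - (z + z⁻¹) • U + 1 := by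
          simp only [sub_mul, mul_sub, Matrix.smul_mul, Matrix.mul_smul, Matrix.one_mul,
            Matrix.mul_one, smul_smul, inv_mul_cancel₀ hz0, one_smul, add_smul]
          abel
        rw [this, Matrix.add_mulVec, Matrix.sub_mulVec, hq, Matrix.smul_mulVec, Matrix.one_mulVec]
        abel
      have hfac : ∀ y : ℂ, y ^ t = 1 → ∃ Q : Matrix G.Dart G.Dart ℂ,
          U ^ t - 1 = Q * (U - y • 1) ∧ Commute Q U := by
        intro y hy
        have hcomm : Commute U (y • (1 : Matrix G.Dart G.Dart ℂ)) :=
          (Commute.one_right U).smul_right y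
        refine ⟨∑ i ∈ Finset.range t, U ^ i * (y • (1 : Matrix G.Dart G.Dart ℂ)) ^ (t - 1 - i),
          ?_, ?_⟩
        · rw [hcomm.geom_sum₂_mul t, smul_pow, one_pow, hy, one_smul]
        · refine Commute.sum_left _ _ _ fun i _ => ?_
          exact ((Commute.refl U).pow_left i).mul_left (hcomm.symm.pow_left _)
      obtain ⟨Q₁, h₁, c₁⟩ := hfac z hz
      obtain ⟨Q₂, h₂, c₂⟩ := hfac z⁻¹ (by rw [inv_pow, hz, inv_one])
      have c₂' : Commute (U - z • (1 : Matrix G.Dart G.Dart ℂ)) Q₂ :=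
        (c₂.sub_right ((Commute.one_right Q₂).smul_right z)).symm
      have : (U ^ t - 1) ^ 2 = Q₁ * Q₂ * ((U - z • 1) * (U - z⁻¹ • 1)) := by
        rw [sq]
        nth_rewrite 1 [h₁]
        rw [h₂, mul_assoc, ← mul_assoc (U - z • 1), c₂'.eq]
        simp only [mul_assoc]
      rw [this, ← Matrix.mulVec_mulVec, ← Matrix.mulVec_mulVec (Nᴴ *ᵥ f j), hv, Matrix.mulVec_zero]
    | zero => simp
    | add x y _ _ hx hy => rw [Matrix.mulVec_add, Matrix.mulVec_add, hx, hy, add_zero]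
    | smul a x _ hx => rw [Matrix.mulVec_smul, Matrix.mulVec_smul, hx, smul_zero]
  have hN : (U ^ t - 1) ^ 2 * Nᴴ = 0 := by
    apply Matrix.ext_of_mulVec_single
    intro i
    rw [← Matrix.mulVec_mulVec, hvec, Matrix.zero_mulVec]
  have hRN : (U ^ t - 1) ^ 2 * (shiftMatrix G * Nᴴ) = 0 := by
    have hc : Commute ((U ^ t - 1) ^ 2) U :=
      (((Commute.refl U).pow_left t).sub_left (Commute.one_left U)).pow_left 2
    rw [← hUN, ← Matrix.mul_assoc, hc.eq, Matrix.mul_assoc, hN, Matrix.mul_zero]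
  -- The range of `U² - 1` lies in the sum of the ranges of `R N*` and `N*`, both killed by `(U ^ t
  -- - 1)²`; on the rest of the arc space `U` only contributes eigenvalues `±1`.
  have hUsq : U ^ 2 - 1 = (shiftMatrix G * Nᴴ) * ((2 : ℂ) • (N * U)) -
      Nᴴ * ((2 : ℂ) • N) := by
    have hU1 : U = (2 : ℂ) • (shiftMatrix G * Nᴴ * N) - shiftMatrix G := by
      rw [hUdef, timeEvolution_eq, Matrix.mul_sub, Matrix.mul_smul, Matrix.mul_one, Matrix.mul_assoc]
    have hRU : shiftMatrix G * U = (2 : ℂ) • (Nᴴ * N) - 1 := by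
      rw [hUdef, timeEvolution_eq, ← Matrix.mul_assoc, shiftMatrix_mul_self, Matrix.one_mul]
    rw [sq]
    nth_rewrite 1 [hU1]
    rw [Matrix.sub_mul, hRU]
    simp only [Matrix.smul_mul, Matrix.mul_smul, Matrix.mul_assoc]
    abel
  have hprod : (U ^ t - 1) ^ 2 * (U ^ 2 - 1) = 0 := by
    rw [hUsq, Matrix.mul_sub, ← Matrix.mul_assoc _ (shiftMatrix G * Nᴴ), ← Matrix.mul_assoc _ Nᴴ, hRN, hN, Matrix.zero_mul,
      Matrix.zero_mul, sub_zero]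
  refine ⟨2 * t, by positivity, ?_⟩
  rw [← hUdef]
  have hU' : U * Uᴴ = 1 := mul_eq_one_comm.mp hUU
  refine sub_eq_zero.mp (eq_zero_of_normal_of_pow_four ?_ ?_)
  · rw [Matrix.conjTranspose_sub, Matrix.conjTranspose_pow, Matrix.conjTranspose_one]
    have : Commute Uᴴ U := hUU.trans hU'.symm
    exact ((this.pow_pow _ _).sub_left (Commute.one_left _)).sub_right (Commute.one_right _)
  · have hdvd : (Polynomial.X ^ t - 1 : Polynomial ℂ) ^ 2 * (Polynomial.X ^ 2 - 1) ∣
        (Polynomial.X ^ (2 * t) - 1) ^ 4 := by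
      have h1 : (Polynomial.X ^ t - 1 : Polynomial ℂ) ∣ Polynomial.X ^ (2 * t) - 1 := by
        rw [mul_comm, pow_mul]; exact sub_one_dvd_pow_sub_one _ _
      have h2 : (Polynomial.X ^ 2 - 1 : Polynomial ℂ) ∣ Polynomial.X ^ (2 * t) - 1 := by
        rw [pow_mul]; exact sub_one_dvd_pow_sub_one _ _
      exact (mul_dvd_mul (pow_dvd_pow_of_dvd h1 2) h2).trans
        (by rw [← pow_succ]; exact pow_dvd_pow _ (by norm_num))
    obtain ⟨Q, hQ⟩ := hdvd
    have := congrArg (Polynomial.aeval U) hQ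
    simp only [map_mul, map_pow, map_sub, map_one, Polynomial.aeval_X] at this
    rw [this, hprod, zero_mul]

end Walk
end GroverWalk
namespace GroverWalk

open Matrix

/-! ### The connection set, character eigenvectors and a sufficient condition. -/

section Cayley

/-- The connection set of the quadratic unitary Cayley graph. -/
noncomputable def connectionSet (n : ℕ) [NeZero n] : Finset (ZMod n) :=
  letI := Classical.decPred fun x : ZMod n => x ∈ unitSquares n ∪ {x | -x ∈ unitSquares n}
  Finset.univ.filter fun x => x ∈ unitSquares n ∪ {x | -x ∈ unitSquares n}

variable {n : ℕ} [NeZero n]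

theorem mem_connectionSet {x : ZMod n} :
    x ∈ connectionSet n ↔ ∃ r : (ZMod n)ˣ, x = (r : ZMod n) ^ 2 ∨ x = -(r : ZMod n) ^ 2 := by
  simp only [connectionSet, Finset.mem_filter, Finset.mem_univ, true_and, Set.mem_union,
    unitSquares, Set.mem_ofPred_eq, neg_eq_iff_eq_neg, exists_or]

theorem neg_mem_connectionSet {x : ZMod n} (hx : x ∈ connectionSet n) : -x ∈ connectionSet n := by
  rw [mem_connectionSet] at hx ⊢
  obtain ⟨r, h | h⟩ := hx
  · exact ⟨r, Or.inr (by rw [h])⟩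
  · exact ⟨r, Or.inl (by rw [h, neg_neg])⟩

theorem one_mem_connectionSet : (1 : ZMod n) ∈ connectionSet n :=
  mem_connectionSet.mpr ⟨1, Or.inl (by simp)⟩

theorem card_connectionSet_pos : 0 < (connectionSet n).card :=
  Finset.card_pos.mpr ⟨1, one_mem_connectionSet⟩

theorem isUnit_of_mem_connectionSet {x : ZMod n} (hx : x ∈ connectionSet n) : IsUnit x := by
  rw [mem_connectionSet] at hx
  obtain ⟨r, h | h⟩ := hx
  · exact h ▸ r.isUnit.pow 2
  · exact h ▸ (r.isUnit.pow 2).neg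

theorem mul_mem_connectionSet {x y : ZMod n} (hx : x ∈ connectionSet n) (hy : y ∈ connectionSet n) :
    x * y ∈ connectionSet n := by
  rw [mem_connectionSet] at hx hy ⊢
  obtain ⟨r, h⟩ := hx
  obtain ⟨s, h'⟩ := hy
  refine ⟨r * s, ?_⟩
  rw [Units.val_mul]
  rcases h with h | h <;> rcases h' with h' | h'
  · left; rw [h, h']; ring
  · right; rw [h, h']; ring
  · right; rw [h, h']; ring
  · left; rw [h, h']; ring

theorem exists_inverse_mem_connectionSet {x : ZMod n} (hx : x ∈ connectionSet n) :
    ∃ y ∈ connectionSet n, x * y = 1 := by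
  obtain ⟨r, h⟩ := mem_connectionSet.mp hx
  have hr : (r : ZMod n) * ((r⁻¹ : (ZMod n)ˣ) : ZMod n) = 1 := r.mul_inv
  rcases h with h | h
  · refine ⟨_, mem_connectionSet.mpr ⟨r⁻¹, Or.inl rfl⟩, ?_⟩
    rw [h, ← mul_pow, hr, one_pow]
  · refine ⟨_, mem_connectionSet.mpr ⟨r⁻¹, Or.inr rfl⟩, ?_⟩
    rw [h, neg_mul_neg, ← mul_pow, hr, one_pow]

theorem adj_iff (hn : 2 ≤ n) {u v : ZMod n} :
    (quadraticUnitaryCayleyGraph n).Adj u v ↔ u - v ∈ connectionSet n := by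
  have : Fact (1 < n) := ⟨hn⟩
  have hmem : ∀ x : ZMod n, x ∈ unitSquares n ∪ {x | -x ∈ unitSquares n} ↔ x ∈ connectionSet n := by
    intro x
    simp [connectionSet]
  rw [quadraticUnitaryCayleyGraph, SimpleGraph.circulantGraph_adj, hmem, hmem]
  constructor
  · rintro ⟨-, h | h⟩
    · exact h
    · rw [← neg_sub]; exact neg_mem_connectionSet h
  · refine fun h => ⟨?_, Or.inl h⟩
    rintro rfl
    rw [sub_self] at h
    exact not_isUnit_zero (isUnit_of_mem_connectionSet h)

variable [DecidableRel (quadraticUnitaryCayleyGraph n).Adj]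

theorem sum_neighborFinset (hn : 2 ≤ n) {M : Type*} [AddCommMonoid M] (x : ZMod n)
    (F : ZMod n → M) :
    ∑ y ∈ (quadraticUnitaryCayleyGraph n).neighborFinset x, F y =
      ∑ s ∈ connectionSet n, F (x - s) := by
  refine Finset.sum_nbij' (fun y => x - y) (fun s => x - s) ?_ ?_ ?_ ?_ ?_
  · intro y hy
    rwa [SimpleGraph.mem_neighborFinset, adj_iff hn] at hy
  · intro s hs
    rwa [SimpleGraph.mem_neighborFinset, adj_iff hn, sub_sub_cancel]
  all_goals simp

theorem degree_eq (hn : 2 ≤ n) (x : ZMod n) :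
    (quadraticUnitaryCayleyGraph n).degree x = (connectionSet n).card := by
  rw [← SimpleGraph.card_neighborFinset_eq_degree, Finset.card_eq_sum_ones, Finset.card_eq_sum_ones,
    sum_neighborFinset hn]

omit [DecidableRel (quadraticUnitaryCayleyGraph n).Adj] in
theorem sum_connectionSet_neg {M : Type*} [AddCommMonoid M] (F : ZMod n → M) :
    ∑ s ∈ connectionSet n, F (-s) = ∑ s ∈ connectionSet n, F s :=
  Finset.sum_nbij' (fun s => -s) (fun s => -s) (fun _ => neg_mem_connectionSet)
    (fun _ => neg_mem_connectionSet) (by simp) (by simp) (by simp)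

theorem adjMatrix_mulVec_addChar (hn : 2 ≤ n) (χ : AddChar (ZMod n) ℂ) :
    (quadraticUnitaryCayleyGraph n).adjMatrix ℂ *ᵥ (χ : ZMod n → ℂ) =
      (∑ s ∈ connectionSet n, χ s) • (χ : ZMod n → ℂ) := by
  ext x
  rw [SimpleGraph.adjMatrix_mulVec_apply, sum_neighborFinset hn, Pi.smul_apply, smul_eq_mul,
    ← sum_connectionSet_neg, Finset.sum_mul]
  refine Finset.sum_congr rfl fun s _ => ?_
  rw [← AddChar.map_add_eq_mul]
  congr 1
  abel

omit [DecidableRel (quadraticUnitaryCayleyGraph n).Adj] in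
theorem two_mul_sum_connectionSet (χ : AddChar (ZMod n) ℂ) :
    2 * ∑ s ∈ connectionSet n, χ s = ∑ s ∈ connectionSet n, (χ s + χ (-s)) := by
  rw [Finset.sum_add_distrib, sum_connectionSet_neg (fun s => χ s), two_mul]

/-- If the connection set is contained in `±1 + H` and stable under translation by `H`, then the
graph is a blow-up of a cycle, hence periodic. -/
theorem isPeriodic_of_addSubgroup (hn : 2 ≤ n) (H : AddSubgroup (ZMod n))
    (h1 : ∀ s ∈ connectionSet n, s - 1 ∈ H ∨ s + 1 ∈ H)
    (h2 : ∀ s ∈ connectionSet n, ∀ h ∈ H, s + h ∈ connectionSet n) :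
    IsPeriodic (quadraticUnitaryCayleyGraph n) := by
  have hk := card_connectionSet_pos (n := n)
  have hk0 : ((connectionSet n).card : ℂ) ≠ 0 := by exact_mod_cast hk.ne'
  -- The exponent `4 * n` serves both kinds of root: `χ 1` has order dividing `n`, and `Complex.I`
  -- has order `4`.
  refine isPeriodic_of_span hk (degree_eq hn) (t := 4 * n) (by omega)
    (fun χ : AddChar (ZMod n) ℂ => (χ : ZMod n → ℂ)) ?_ fun χ => ?_
  · rw [← AddChar.coe_complexBasis]
    exact (AddChar.complexBasis (ZMod n)).span_eq
  refine ⟨∑ s ∈ connectionSet n, χ s, ?_⟩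
  by_cases hχ : ∀ h ∈ H, χ h = 1
  · refine ⟨χ 1, adjMatrix_mulVec_addChar hn χ, ?_, ?_⟩
    · rw [mul_comm, pow_mul, ← AddChar.map_nsmul_eq_pow]
      simp
    · have hval : ∀ s ∈ connectionSet n, χ s + χ (-s) = χ 1 + (χ 1)⁻¹ := by
        intro s hs
        rw [AddChar.map_neg_eq_inv]
        rcases h1 s hs with h | h
        · rw [← sub_add_cancel s 1, AddChar.map_add_eq_mul, hχ _ h, one_mul]
        · have : χ s = (χ 1)⁻¹ := by
            rw [← add_sub_cancel_right s 1, sub_eq_add_neg, AddChar.map_add_eq_mul, hχ _ h, one_mul,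
              AddChar.map_neg_eq_inv]
          rw [this, inv_inv, add_comm]
      rw [two_mul_sum_connectionSet, Finset.sum_congr rfl hval, Finset.sum_const, nsmul_eq_mul,
        mul_div_cancel_left₀ _ hk0]
  · push Not at hχ
    obtain ⟨h, hH, hne⟩ := hχ
    refine ⟨Complex.I, adjMatrix_mulVec_addChar hn χ, ?_, ?_⟩
    · rw [pow_mul, Complex.I_pow_four, one_pow]
    · have hshift : ∑ s ∈ connectionSet n, χ s = χ h * ∑ s ∈ connectionSet n, χ s := by
        rw [Finset.mul_sum]
        refine Finset.sum_nbij' (fun s => s + -h) (fun s => s + h)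
          (fun s hs => h2 s hs _ (H.neg_mem hH)) (fun s hs => h2 s hs _ hH) (by simp) (by simp) ?_
        intro s _
        rw [← AddChar.map_add_eq_mul]
        congr 1
        abel
      have h0 : ∑ s ∈ connectionSet n, χ s = 0 := by
        have : (χ h - 1) * ∑ s ∈ connectionSet n, χ s = 0 := by rw [sub_mul, ← hshift, one_mul, sub_self]
        exact (mul_eq_zero.mp this).resolve_left (sub_ne_zero.mpr hne)
      rw [h0, Complex.inv_I]
      simp

end Cayley

/-! ### Passing from `n` to a divisor `m`. -/

section Lifting

variable {n m : ℕ} [NeZero n] [NeZero m]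

omit [NeZero n] [NeZero m] in
theorem coe_unitsMap (hmn : m ∣ n) (r : (ZMod n)ˣ) :
    (ZMod.unitsMap hmn r : ZMod m) = ZMod.castHom hmn (ZMod m) r := rfl

theorem cast_mem_connectionSet (hmn : m ∣ n) {x : ZMod n} (hx : x ∈ connectionSet n) :
    ZMod.castHom hmn (ZMod m) x ∈ connectionSet m := by
  rw [mem_connectionSet] at hx ⊢
  obtain ⟨r, h⟩ := hx
  refine ⟨ZMod.unitsMap hmn r, h.imp ?_ ?_⟩ <;> intro h <;>
    simp only [h, coe_unitsMap, map_pow, map_neg]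

theorem exists_cast_eq_of_mem_connectionSet (hmn : m ∣ n) {y : ZMod m} (hy : y ∈ connectionSet m) :
    ∃ x ∈ connectionSet n, ZMod.castHom hmn (ZMod m) x = y := by
  obtain ⟨r, h⟩ := mem_connectionSet.mp hy
  obtain ⟨R, rfl⟩ := ZMod.unitsMap_surjective hmn r
  rcases h with rfl | rfl
  · exact ⟨_, mem_connectionSet.mpr ⟨R, Or.inl rfl⟩, by rw [coe_unitsMap, ← map_pow]⟩
  · exact ⟨_, mem_connectionSet.mpr ⟨R, Or.inr rfl⟩, by rw [coe_unitsMap, ← map_pow, ← map_neg]⟩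

theorem sum_connectionSet_mul {M : Type*} [AddCommMonoid M] (F : ZMod n → M) {u : ZMod n}
    (hu : u ∈ connectionSet n) :
    ∑ s ∈ connectionSet n, F (s * u) = ∑ s ∈ connectionSet n, F s := by
  obtain ⟨v, hv, huv⟩ := exists_inverse_mem_connectionSet hu
  refine Finset.sum_nbij' (fun s => s * u) (fun s => s * v)
    (fun s hs => mul_mem_connectionSet hs hu) (fun s hs => mul_mem_connectionSet hs hv) ?_ ?_ ?_
  · intro s _
    simp only [mul_assoc, huv, mul_one]
  · intro s _
    simp only [mul_assoc, mul_comm v u, huv, mul_one]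
  · simp

/-- The average of a function over the connection set is unchanged by inflation. -/
theorem card_mul_sum_connectionSet_cast (hmn : m ∣ n) (F : ZMod m → ℂ) :
    ((connectionSet m).card : ℂ) * ∑ s ∈ connectionSet n, F (ZMod.castHom hmn (ZMod m) s) =
      (connectionSet n).card * ∑ s ∈ connectionSet m, F s := by
  -- Average `F(s t)` over both connection sets: lifting `t` to `ℤ_n`, its multiplication permutes
  -- the upper set, while multiplication by the image of `s` permutes the lower one.
  calc _ = ∑ t ∈ connectionSet m, ∑ s ∈ connectionSet n, F (ZMod.castHom hmn (ZMod m) s * t) := by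
        rw [← nsmul_eq_mul, ← Finset.sum_const]
        refine Finset.sum_congr rfl fun t ht => ?_
        obtain ⟨T, hT, rfl⟩ := exists_cast_eq_of_mem_connectionSet hmn ht
        rw [← sum_connectionSet_mul _ hT]
        simp only [map_mul]
    _ = ∑ s ∈ connectionSet n, ∑ t ∈ connectionSet m, F (t * ZMod.castHom hmn (ZMod m) s) := by
        rw [Finset.sum_comm]
        simp only [mul_comm]
    _ = _ := by
        rw [← nsmul_eq_mul, ← Finset.sum_const]
        exact Finset.sum_congr rfl fun s hs =>
          sum_connectionSet_mul F (cast_mem_connectionSet hmn hs)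

theorem isIntegral_average (hn : 2 ≤ n) [DecidableRel (quadraticUnitaryCayleyGraph n).Adj]
    (hper : IsPeriodic (quadraticUnitaryCayleyGraph n)) (hmn : m ∣ n) (ψ : AddChar (ZMod m) ℂ) :
    IsIntegral ℤ (2 * (∑ s ∈ connectionSet m, ψ s) / (connectionSet m).card) := by
  have hkn : ((connectionSet n).card : ℂ) ≠ 0 := by exact_mod_cast card_connectionSet_pos.ne'
  have hkm : ((connectionSet m).card : ℂ) ≠ 0 := by exact_mod_cast card_connectionSet_pos.ne'
  set χ : AddChar (ZMod n) ℂ := ψ.compAddMonoidHom (ZMod.castHom hmn (ZMod m)).toAddMonoidHom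
  have h := hper.isIntegral card_connectionSet_pos (degree_eq hn) (f := χ)
    (fun h0 => by simpa using congrFun h0 0) (adjMatrix_mulVec_addChar hn χ)
  have hav := card_mul_sum_connectionSet_cast hmn ψ
  convert h using 1
  rw [div_eq_div_iff hkm hkn]
  have hχ : ∑ s ∈ connectionSet n, χ s = ∑ s ∈ connectionSet n, ψ (ZMod.castHom hmn (ZMod m) s) := rfl
  rw [hχ]
  linear_combination -2 * hav

theorem isIntegral_average_root (hn : 2 ≤ n) [DecidableRel (quadraticUnitaryCayleyGraph n).Adj]
    (hper : IsPeriodic (quadraticUnitaryCayleyGraph n)) (hmn : m ∣ n) {ζ : ℂ} (hζ : ζ ^ m = 1) :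
    IsIntegral ℤ (2 * (∑ s ∈ connectionSet m, ζ ^ s.val) / (connectionSet m).card) := by
  simpa only [AddChar.zmodChar_apply] using isIntegral_average hn hper hmn (AddChar.zmodChar m hζ)

end Lifting
end GroverWalk
namespace GroverWalk

/-! ### Excluded divisors: `15`, `40` and primes at least `7`. -/

section Obstructions

theorem not_isIntegral_of_eq_div {a b : ℤ} (hb : b ≠ 0) (h : ¬ b ∣ a) {x : ℂ}
    (hx : x = (a : ℂ) / b) : ¬ IsIntegral ℤ x := by
  subst hx
  intro hi
  have h' : IsIntegral ℤ ((a : ℚ) / b) :=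
    (isIntegral_algebraMap_iff (B := ℂ) (algebraMap ℚ ℂ).injective).mp (by simpa using hi)
  obtain ⟨z, hz⟩ := IsIntegrallyClosed.isIntegral_iff.mp h'
  have hb' : (b : ℚ) ≠ 0 := by exact_mod_cast hb
  rw [eq_div_iff hb', eq_intCast] at hz
  exact h ⟨z, by rw [mul_comm]; exact_mod_cast hz.symm⟩

theorem connectionSet_fifteen : connectionSet 15 = {1, 4, 11, 14} := by
  have hsq : ∀ r : ZMod 15, r.val.Coprime 15 → r ^ 2 = 1 ∨ r ^ 2 = 4 := by decide
  ext x
  simp only [mem_connectionSet, Finset.mem_insert, Finset.mem_singleton]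
  constructor
  · rintro ⟨r, h⟩
    have h2 := hsq r (ZMod.val_coe_unit_coprime r)
    rcases h with rfl | rfl <;> rcases h2 with h2 | h2 <;> rw [h2] <;> decide
  · rintro (rfl | rfl | rfl | rfl)
    · exact ⟨1, Or.inl (by simp)⟩
    · exact ⟨ZMod.unitOfCoprime 2 (by decide), Or.inl (by decide)⟩
    · exact ⟨ZMod.unitOfCoprime 2 (by decide), Or.inr (by decide)⟩
    · exact ⟨1, Or.inr (by decide)⟩

theorem connectionSet_forty : connectionSet 40 = {1, 9, 31, 39} := by
  have hsq : ∀ r : ZMod 40, r.val.Coprime 40 → r ^ 2 = 1 ∨ r ^ 2 = 9 := by decide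
  ext x
  simp only [mem_connectionSet, Finset.mem_insert, Finset.mem_singleton]
  constructor
  · rintro ⟨r, h⟩
    have h2 := hsq r (ZMod.val_coe_unit_coprime r)
    rcases h with rfl | rfl <;> rcases h2 with h2 | h2 <;> rw [h2] <;> decide
  · rintro (rfl | rfl | rfl | rfl)
    · exact ⟨1, Or.inl (by simp)⟩
    · exact ⟨ZMod.unitOfCoprime 3 (by decide), Or.inl (by decide)⟩
    · exact ⟨ZMod.unitOfCoprime 3 (by decide), Or.inr (by decide)⟩
    · exact ⟨1, Or.inr (by decide)⟩

theorem sum_connectionSet_fifteen (ζ : ℂ) :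
    2 * (∑ s ∈ connectionSet 15, ζ ^ s.val) / (connectionSet 15).card =
      (ζ + ζ ^ 4 + ζ ^ 11 + ζ ^ 14) / 2 := by
  have hc : (connectionSet 15).card = 4 := by rw [connectionSet_fifteen]; decide
  have h1 : (1 : ZMod 15).val = 1 := by decide
  have h2 : (4 : ZMod 15).val = 4 := by decide
  have h3 : (11 : ZMod 15).val = 11 := by decide
  have h4 : (14 : ZMod 15).val = 14 := by decide
  rw [hc, connectionSet_fifteen, Finset.sum_insert (by decide), Finset.sum_insert (by decide),
    Finset.sum_insert (by decide), Finset.sum_singleton, h1, h2, h3, h4]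
  push_cast
  ring

theorem sum_connectionSet_forty (ζ : ℂ) :
    2 * (∑ s ∈ connectionSet 40, ζ ^ s.val) / (connectionSet 40).card =
      (ζ + ζ ^ 9 + ζ ^ 31 + ζ ^ 39) / 2 := by
  have hc : (connectionSet 40).card = 4 := by rw [connectionSet_forty]; decide
  have h1 : (1 : ZMod 40).val = 1 := by decide
  have h2 : (9 : ZMod 40).val = 9 := by decide
  have h3 : (31 : ZMod 40).val = 31 := by decide
  have h4 : (39 : ZMod 40).val = 39 := by decide
  rw [hc, connectionSet_forty, Finset.sum_insert (by decide), Finset.sum_insert (by decide),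
    Finset.sum_insert (by decide), Finset.sum_singleton, h1, h2, h3, h4]
  push_cast
  ring

variable {n : ℕ} [NeZero n] [DecidableRel (quadraticUnitaryCayleyGraph n).Adj]

theorem not_fifteen_dvd_of_isPeriodic (hn : 2 ≤ n)
    (hper : IsPeriodic (quadraticUnitaryCayleyGraph n)) : ¬ 15 ∣ n := by
  intro h
  have hprim := Complex.isPrimitiveRoot_exp 15 (by norm_num)
  generalize Complex.exp (2 * Real.pi * Complex.I / (15 : ℕ)) = ζ at hprim
  have h15 := hprim.pow_eq_one
  have h5 : ζ ^ 5 - 1 ≠ 0 := sub_ne_zero.mpr (hprim.pow_ne_one_of_pos_of_lt (by norm_num) (by norm_num))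
  have h3 : ζ ^ 3 - 1 ≠ 0 := sub_ne_zero.mpr (hprim.pow_ne_one_of_pos_of_lt (by norm_num) (by norm_num))
  -- The fifteenth cyclotomic polynomial, from `(x⁵ - 1)(x³ - 1) Φ₁₅ = (x - 1)(x¹⁵ - 1)`.
  have hΦ : ζ ^ 8 - ζ ^ 7 + ζ ^ 5 - ζ ^ 4 + ζ ^ 3 - ζ + 1 = 0 := by
    have : (ζ ^ 5 - 1) * (ζ ^ 3 - 1) * (ζ ^ 8 - ζ ^ 7 + ζ ^ 5 - ζ ^ 4 + ζ ^ 3 - ζ + 1) = 0 := by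
      linear_combination (ζ - 1) * h15
    exact (mul_eq_zero.mp this).resolve_left (mul_ne_zero h5 h3)
  have i1 := isIntegral_average_root hn hper h h15
  have i2 := isIntegral_average_root hn hper h (ζ := ζ ^ 2) (by rw [← pow_mul, mul_comm, pow_mul, h15, one_pow])
  rw [sum_connectionSet_fifteen] at i1 i2
  have e22 : ζ ^ 22 = ζ ^ 7 := by linear_combination ζ ^ 7 * h15
  have e28 : ζ ^ 28 = ζ ^ 13 := by linear_combination ζ ^ 13 * h15
  -- The exponents for `ζ` and `ζ ^ 2` together exhaust the units modulo `15`; the sum of all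
  -- primitive roots is `1`, so the two doubled averages add up to `1/2`.
  have hall : ζ + ζ ^ 2 + ζ ^ 4 + ζ ^ 7 + ζ ^ 8 + ζ ^ 11 + ζ ^ 13 + ζ ^ 14 = 1 := by
    linear_combination (ζ ^ 6 + 2 * ζ ^ 5 + 2 * ζ ^ 4 + 2 * ζ ^ 3 + ζ ^ 2 - 1) * hΦ
  refine not_isIntegral_of_eq_div (a := 1) (b := 2) (by norm_num) (by norm_num) ?_ (i1.add i2)
  push_cast
  linear_combination hall / 2 + e22 / 2 + e28 / 2

theorem not_forty_dvd_of_isPeriodic (hn : 2 ≤ n)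
    (hper : IsPeriodic (quadraticUnitaryCayleyGraph n)) : ¬ 40 ∣ n := by
  intro h
  have hprim := Complex.isPrimitiveRoot_exp 40 (by norm_num)
  generalize Complex.exp (2 * Real.pi * Complex.I / (40 : ℕ)) = ζ at hprim
  have h40 := hprim.pow_eq_one
  have h20 : ζ ^ 20 = -1 := by
    have h1 : ζ ^ 20 - 1 ≠ 0 :=
      sub_ne_zero.mpr (hprim.pow_ne_one_of_pos_of_lt (by norm_num) (by norm_num))
    have : (ζ ^ 20 - 1) * (ζ ^ 20 + 1) = 0 := by linear_combination h40
    linear_combination (mul_eq_zero.mp this).resolve_left h1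
  have h8 : ζ ^ 8 - 1 ≠ 0 := sub_ne_zero.mpr (hprim.pow_ne_one_of_pos_of_lt (by norm_num) (by norm_num))
  have hΦ : ζ ^ 16 - ζ ^ 12 + ζ ^ 8 - ζ ^ 4 + 1 = 0 := by
    have : (ζ ^ 8 - 1) * (ζ ^ 16 - ζ ^ 12 + ζ ^ 8 - ζ ^ 4 + 1) = 0 := by
      linear_combination (ζ ^ 4 - 1) * h20
    exact (mul_eq_zero.mp this).resolve_left h8
  have i1 := isIntegral_average_root hn hper h h40
  have i3 := isIntegral_average_root hn hper h (ζ := ζ ^ 3) (by rw [← pow_mul, mul_comm, pow_mul, h40, one_pow])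
  rw [sum_connectionSet_forty] at i1 i3
  have e31 : ζ ^ 31 = -ζ ^ 11 := by linear_combination ζ ^ 11 * h20
  have e39 : ζ ^ 39 = -ζ ^ 19 := by linear_combination ζ ^ 19 * h20
  have e27 : ζ ^ 27 = -ζ ^ 7 := by linear_combination ζ ^ 7 * h20
  have e93 : ζ ^ 93 = ζ ^ 13 := by linear_combination (ζ ^ 13 + ζ ^ 53) * h40
  have e117 : ζ ^ 117 = -ζ ^ 17 := by
    linear_combination (ζ ^ 37 + ζ ^ 77) * h40 + ζ ^ 17 * h20
  -- The primitive 40th roots sum to `0`, so adding conjugates gives no obstruction. The product of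
  -- two conjugate doubled averages is `2/4 = 1/2` instead.
  have hprod : (ζ + ζ ^ 9 - ζ ^ 11 - ζ ^ 19) * (ζ ^ 3 - ζ ^ 7 + ζ ^ 13 - ζ ^ 17) = 2 := by
    linear_combination (ζ ^ 20 - ζ ^ 4 - 2) * hΦ
  refine not_isIntegral_of_eq_div (a := 1) (b := 2) (by norm_num) (by norm_num) ?_ (i1.mul i3)
  rw [← pow_mul, ← pow_mul, ← pow_mul, show 3 * 9 = 27 from rfl, show 3 * 31 = 93 from rfl,
    show 3 * 39 = 117 from rfl, e31, e39, e27, e93, e117]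
  push_cast
  linear_combination hprod / 4

theorem not_prime_dvd_of_isPeriodic (hn : 2 ≤ n)
    (hper : IsPeriodic (quadraticUnitaryCayleyGraph n)) {p : ℕ} (hp : p.Prime) (h7 : 7 ≤ p) :
    ¬ p ∣ n := by
  intro h
  have : Fact p.Prime := ⟨hp⟩
  obtain ⟨a, ha⟩ := FiniteField.exists_nonsquare (F := ZMod p) (by rw [ZMod.ringChar_zmod_n]; omega)
  have ha0 : a ≠ 0 := by rintro rfl; exact ha (IsSquare.zero)
  set ψ : AddChar (ZMod p) ℂ := ZMod.stdAddChar
  have hsum : ∑ x ∈ Finset.univ.erase (0 : ZMod p), ψ x = -1 := by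
    have h0 : ∑ x : ZMod p, ψ x = 0 := by
      refine AddChar.sum_eq_zero_of_ne_one ?_
      simpa using ZMod.isPrimitive_stdAddChar p one_ne_zero
    rw [← Finset.add_sum_erase _ _ (Finset.mem_univ 0), AddChar.map_zero_eq_one] at h0
    linear_combination h0
  have hcardE : (Finset.univ.erase (0 : ZMod p)).card = p - 1 := by
    rw [Finset.card_erase_of_mem (Finset.mem_univ _), Finset.card_univ, ZMod.card]
  have hmem : ∀ x : ZMod p, x ∈ connectionSet p ↔ x ≠ 0 ∧ (IsSquare x ∨ IsSquare (-x)) := by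
    intro x
    constructor
    · intro hx
      refine ⟨(isUnit_of_mem_connectionSet hx).ne_zero, ?_⟩
      obtain ⟨r, rfl | rfl⟩ := mem_connectionSet.mp hx
      · exact Or.inl ⟨r, sq _⟩
      · exact Or.inr ⟨r, by rw [neg_neg, sq]⟩
    · rintro ⟨hx, ⟨r, hr⟩ | ⟨r, hr⟩⟩
      · have : r ≠ 0 := by rintro rfl; exact hx (by simpa using hr)
        exact mem_connectionSet.mpr ⟨Units.mk0 r this, Or.inl (by rw [hr, Units.val_mk0, sq])⟩
      · have : r ≠ 0 := by rintro rfl; exact hx (by simpa using hr)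
        exact mem_connectionSet.mpr ⟨Units.mk0 r this, Or.inr (by rw [Units.val_mk0, sq, ← hr, neg_neg])⟩
  have hmulsq : ∀ x y : ZMod p, ¬ IsSquare x → ¬ IsSquare y → IsSquare (x * y) := by
    intro x y hx hy
    have hx0 : x ≠ 0 := by rintro rfl; exact hx IsSquare.zero
    have hy0 : y ≠ 0 := by rintro rfl; exact hy IsSquare.zero
    rw [← quadraticChar_one_iff_isSquare (mul_ne_zero hx0 hy0), map_mul,
      quadraticChar_neg_one_iff_not_isSquare.mpr hx, quadraticChar_neg_one_iff_not_isSquare.mpr hy]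
    norm_num
  -- If `-1` is a square, `S` and its translate `a S` partition the nonzero residues, and the two
  -- doubled averages sum to `-4/(p - 1)`. Otherwise `S` is everything nonzero and one doubled
  -- average is `-2/(p - 1)`. Neither is an integer for `p ≥ 7`.
  by_cases hneg : IsSquare (-1 : ZMod p)
  · have hS : ∀ x : ZMod p, x ∈ connectionSet p ↔ x ≠ 0 ∧ IsSquare x := by
      intro x
      rw [hmem]
      refine and_congr_right fun _ => ⟨?_, Or.inl⟩
      rintro (h | h)
      · exact h
      · simpa using hneg.mul h
    have hsplit : ∀ F : ZMod p → ℂ, ∑ x ∈ Finset.univ.erase 0, F x =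
        ∑ s ∈ connectionSet p, F s + ∑ s ∈ connectionSet p, F (a * s) := by
      intro F
      rw [← Finset.sum_filter_add_sum_filter_not _ (fun x => x ∈ connectionSet p)]
      congr 1
      · refine Finset.sum_congr ?_ fun _ _ => rfl
        ext x
        simp only [Finset.mem_filter, Finset.mem_erase, Finset.mem_univ, and_true, hS]
        tauto
      · refine Finset.sum_nbij' (fun x => a⁻¹ * x) (fun s => a * s) ?_ ?_ ?_ ?_ ?_
        · intro x hx
          simp only [Finset.mem_filter, Finset.mem_erase, Finset.mem_univ, and_true, hS] at hx ⊢
          refine ⟨mul_ne_zero (inv_ne_zero ha0) hx.1, hmulsq _ _ (by simpa using ha) ?_⟩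
          tauto
        · intro s hs
          simp only [Finset.mem_filter, Finset.mem_erase, Finset.mem_univ, and_true, hS] at hs ⊢
          refine ⟨mul_ne_zero ha0 hs.1, fun h2 => ha ?_⟩
          have := h2.2.mul hs.2.inv
          rwa [mul_assoc, mul_inv_cancel₀ hs.1, mul_one] at this
        · intro x _; simp [ha0]
        · intro x _; simp [ha0]
        · intro x _; simp [ha0]
    have hcard : (p : ℂ) - 1 = 2 * (connectionSet p).card := by
      have := hsplit fun _ => 1
      simp only [Finset.sum_const, hcardE, nsmul_eq_mul, mul_one] at this
      rw [Nat.cast_sub hp.one_lt.le, Nat.cast_one] at this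
      rw [this]; ring
    have hc0 : ((connectionSet p).card : ℂ) ≠ 0 := by exact_mod_cast card_connectionSet_pos.ne'
    have i1 := isIntegral_average hn hper h ψ
    have i2 := isIntegral_average hn hper h (AddChar.mulShift ψ a)
    refine not_isIntegral_of_eq_div (a := -4) (b := (p : ℤ) - 1) (by omega) ?_ ?_ (i1.add i2)
    · rw [Int.dvd_neg]
      intro hd
      have := Int.le_of_dvd (by norm_num) hd
      omega
    · have h2 := (hsplit ψ).symm.trans hsum
      simp only [AddChar.mulShift_apply]
      push_cast
      rw [hcard]
      field_simp
      linear_combination 4 * h2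
  · have hS : connectionSet p = Finset.univ.erase 0 := by
      ext x
      rw [hmem, Finset.mem_erase]
      simp only [Finset.mem_univ, and_true, and_iff_left_iff_imp]
      intro _
      by_contra! hx
      exact hx.2 (by simpa using hmulsq _ _ hneg hx.1)
    have i1 := isIntegral_average hn hper h ψ
    rw [hS, hsum, hcardE, Nat.cast_sub hp.one_lt.le] at i1
    refine not_isIntegral_of_eq_div (a := -2) (b := (p : ℤ) - 1) (by omega) ?_ ?_ i1
    · rw [Int.dvd_neg]
      intro hd
      have := Int.le_of_dvd (by norm_num) hd
      omega
    · push_cast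
      ring

end Obstructions
end GroverWalk
namespace GroverWalk

/-! ### Periodicity of the listed families. -/

section Periodic

/-- A finite form of Hensel lifting: differences of values factor as `(c + d(x + y))(x - y)`, whose
first factor is a unit plus a nilpotent, so the map is injective. -/
theorem surjective_mul_add_mul_sq {R : Type*} [CommRing R] [Finite R] {c d : R} (hc : IsUnit c)
    (hd : IsNilpotent d) : Function.Surjective fun y : R => c * y + d * y ^ 2 := by
  refine Finite.surjective_of_injective fun x y h => ?_
  have hu : IsUnit (c + d * (x + y)) :=
    IsNilpotent.isUnit_add_left_of_commute ((Commute.all d _).isNilpotent_mul_right hd) hc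
      (Commute.all _ _)
  have h : c * x + d * x ^ 2 = c * y + d * y ^ 2 := h
  have : (c + d * (x + y)) * (x - y) = 0 := by linear_combination h
  exact sub_eq_zero.mp ((hu.mul_right_eq_zero).mp this)

theorem isNilpotent_natCast_of_dvd_pow {n d k : ℕ} (h : n ∣ d ^ k) : IsNilpotent (d : ZMod n) :=
  ⟨k, by rw [← Nat.cast_pow]; exact (ZMod.natCast_eq_zero_iff _ _).mpr h⟩

/-- Needed because `d` may have prime factors that `n` lacks: lifting the unit to `ℤ/dn` gives a
representative coprime to both. -/
theorem exists_coprime_lift {n : ℕ} [NeZero n] (d : ℕ) [NeZero d] (r : (ZMod n)ˣ) :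
    ∃ a : ℕ, a.Coprime d ∧ (r : ZMod n) = a := by
  obtain ⟨R, rfl⟩ := ZMod.unitsMap_surjective (Dvd.intro_left d rfl : n ∣ d * n) r
  refine ⟨(R : ZMod (d * n)).val, (ZMod.val_coe_unit_coprime R).coprime_mul_right_right, ?_⟩
  rw [coe_unitsMap, ZMod.castHom_apply, ZMod.natCast_val]

variable {n : ℕ} [NeZero n] [DecidableRel (quadraticUnitaryCayleyGraph n).Adj]

/-- A criterion for periodicity: it suffices to study units congruent to `1` modulo `d`. -/
theorem isPeriodic_of_one_add_mem (hn : 2 ≤ n) (d : ℕ) [NeZero d]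
    (hsq : ∀ a : ℕ, a.Coprime d → (d : ℤ) ∣ (a : ℤ) ^ 2 - 1 ∨ (d : ℤ) ∣ (a : ℤ) ^ 2 + 1)
    (hone : ∀ t : ZMod n, 1 + d * t ∈ connectionSet n) :
    IsPeriodic (quadraticUnitaryCayleyGraph n) := by
  have hH : ∀ x : ZMod n, x ∈ (Ideal.span {(d : ZMod n)}).toAddSubgroup ↔ ∃ t, x = d * t := fun x =>
    Ideal.mem_span_singleton
  refine isPeriodic_of_addSubgroup hn (Ideal.span {(d : ZMod n)}).toAddSubgroup ?_ ?_
  · have hr : ∀ r : (ZMod n)ˣ, (∃ t : ZMod n, (r : ZMod n) ^ 2 - 1 = d * t) ∨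
        ∃ t : ZMod n, (r : ZMod n) ^ 2 + 1 = d * t := by
      intro r
      obtain ⟨a, ha, hra⟩ := exists_coprime_lift d r
      rw [hra]
      refine (hsq a ha).imp ?_ ?_ <;> rintro ⟨q, hq⟩ <;> refine ⟨q, ?_⟩ <;>
        simpa using congrArg (Int.cast : ℤ → ZMod n) hq
    intro s hs
    rw [hH, hH]
    obtain ⟨r, rfl | rfl⟩ := mem_connectionSet.mp hs
    · exact hr r
    · rcases hr r with ⟨t, ht⟩ | ⟨t, ht⟩
      · exact Or.inr ⟨-t, by linear_combination -ht⟩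
      · exact Or.inl ⟨-t, by linear_combination -ht⟩
  · intro s hs h hh
    obtain ⟨t, rfl⟩ := (hH h).mp hh
    obtain ⟨u, hu, hsu⟩ := exists_inverse_mem_connectionSet hs
    -- With `u = s⁻¹`, `s + d t = s (1 + d u t)`.
    convert mul_mem_connectionSet hs (hone (u * t)) using 1
    linear_combination -(d : ZMod n) * t * hsu

theorem isPeriodic_two_pow_mul_three_pow (hn : 2 ≤ n) {α β : ℕ} (h : n = 2 ^ α * 3 ^ β) :
    IsPeriodic (quadraticUnitaryCayleyGraph n) := by
  have hdvd : n ∣ 6 ^ (α + β) := by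
    rw [h, pow_add]
    exact mul_dvd_mul (pow_dvd_pow_of_dvd (by norm_num) _) (pow_dvd_pow_of_dvd (by norm_num) _)
  have hnil : IsNilpotent ((6 : ℕ) : ZMod n) := isNilpotent_natCast_of_dvd_pow hdvd
  refine isPeriodic_of_one_add_mem hn 24 ?_ fun t => ?_
  · intro a ha
    left
    have hmod : ∀ b < 24, b.Coprime 24 → b ^ 2 % 24 = 1 := by decide
    have h1 := hmod (a % 24) (Nat.mod_lt _ (by norm_num)) (by
      rw [Nat.Coprime, ← Nat.gcd_rec, Nat.gcd_comm]; exact ha)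
    rw [← Nat.pow_mod] at h1
    have : ((a ^ 2 : ℕ) : ℤ) % 24 = 1 := by exact_mod_cast h1
    push_cast at this ⊢
    omega
  -- `(1 + 12y)² = 1 + 24(y + 6y²)`, so it suffices to solve `y + 6y² = t`.
  · obtain ⟨y, hy⟩ := surjective_mul_add_mul_sq isUnit_one hnil t
    have hu : IsUnit (1 + 12 * y) := by
      have : (12 : ZMod n) * y = ((6 : ℕ) : ZMod n) * (2 * y) := by push_cast; ring
      rw [this, add_comm]
      exact ((Commute.all _ _).isNilpotent_mul_right hnil).isUnit_add_one
    refine mem_connectionSet.mpr ⟨hu.unit, Or.inl ?_⟩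
    rw [IsUnit.unit_spec]
    push_cast at hy ⊢
    linear_combination -24 * hy

theorem exists_int_modEq_five_pow {c : ℤ} (hc : ¬ (5 : ℤ) ∣ c) (γ : ℕ) (t : ℤ) :
    ∃ y : ℤ, (5 ^ γ : ℤ) ∣ c * y + 5 * y ^ 2 - t := by
  have hnil : IsNilpotent ((5 : ℕ) : ZMod (5 ^ γ)) := isNilpotent_natCast_of_dvd_pow dvd_rfl
  have hcu : IsUnit ((c : ℤ) : ZMod (5 ^ γ)) := by
    rw [ZMod.coe_int_isUnit_iff_isCoprime]
    push_cast
    exact (((Int.prime_iff_natAbs_prime.mpr (by norm_num)).coprime_iff_not_dvd).mpr hc).pow_left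
  have : NeZero (5 ^ γ) := ⟨by positivity⟩
  obtain ⟨y, hy⟩ := surjective_mul_add_mul_sq hcu hnil (t : ZMod (5 ^ γ))
  obtain ⟨y, rfl⟩ := ZMod.intCast_surjective y
  refine ⟨y, ?_⟩
  have h2 : ((c * y + 5 * y ^ 2 - t : ℤ) : ZMod (5 ^ γ)) = 0 := by
    push_cast at hy ⊢
    rw [hy, sub_self]
  have := (ZMod.intCast_zmod_eq_zero_iff_dvd _ _).mp h2
  exact_mod_cast this

theorem isPeriodic_two_pow_mul_five_pow (hn : 2 ≤ n) {δ γ : ℕ} (hδ : δ ≤ 2)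
    (h : n = 2 ^ δ * 5 ^ γ) : IsPeriodic (quadraticUnitaryCayleyGraph n) := by
  have hdvd : n ∣ 10 ^ (δ + γ) := by
    rw [h, pow_add]
    exact mul_dvd_mul (pow_dvd_pow_of_dvd (by norm_num) _) (pow_dvd_pow_of_dvd (by norm_num) _)
  -- This is where `δ ≤ 2` enters: congruences multiplied by `20` need only be solved modulo `5 ^
  -- γ`.
  have hdvd' : (n : ℤ) ∣ 20 * 5 ^ γ := by
    have : (2 : ℤ) ^ δ ∣ 20 := (pow_dvd_pow 2 hδ).trans (by norm_num)
    rw [h]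
    push_cast
    exact mul_dvd_mul this dvd_rfl
  have hnil : IsNilpotent ((10 : ℕ) : ZMod n) := isNilpotent_natCast_of_dvd_pow hdvd
  have hunit : ∀ c y : ZMod n, IsUnit c → IsUnit (c + 10 * y) := by
    intro c y hc
    refine IsNilpotent.isUnit_add_left_of_commute ?_ hc (Commute.all _ _)
    exact_mod_cast (Commute.all _ _).isNilpotent_mul_right hnil
  have h3 : IsUnit (3 : ZMod n) := by
    have := (ZMod.isUnit_iff_coprime 3 n).mpr (by
      rw [h]
      exact Nat.Coprime.mul_right (Nat.Coprime.pow_right _ (by norm_num))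
        (Nat.Coprime.pow_right _ (by norm_num)))
    exact_mod_cast this
  refine isPeriodic_of_one_add_mem hn 10 ?_ fun t => ?_
  · intro a ha
    have hmod : ∀ b < 10, b.Coprime 10 → b ^ 2 % 10 = 1 ∨ b ^ 2 % 10 = 9 := by decide
    have h1 := hmod (a % 10) (Nat.mod_lt _ (by norm_num)) (by
      rw [Nat.Coprime, ← Nat.gcd_rec, Nat.gcd_comm]; exact ha)
    rw [← Nat.pow_mod] at h1
    have : ((a ^ 2 : ℕ) : ℤ) % 10 = 1 ∨ ((a ^ 2 : ℕ) : ℤ) % 10 = 9 := by exact_mod_cast h1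
    push_cast at this ⊢
    omega
  -- For `t = 2u`, use `(1 + 10y)² = 1 + 20(y + 5y²)`. For `t = 2u + 1`, use `-(3 + 10y)² = -9 -
  -- 20(3y + 5y²)`, which equals `11 + 20u` once `3y + 5y² = -(u + 1)`.
  · obtain ⟨t, rfl⟩ := ZMod.intCast_surjective t
    rcases Int.even_or_odd' t with ⟨u, rfl | rfl⟩
    · obtain ⟨y, hy⟩ := exists_int_modEq_five_pow (c := 1) (by norm_num) γ u
      refine mem_connectionSet.mpr ⟨(hunit 1 y isUnit_one).unit, Or.inl ?_⟩
      have := (ZMod.intCast_zmod_eq_zero_iff_dvd _ n).mpr (hdvd'.trans (mul_dvd_mul_left 20 hy))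
      rw [IsUnit.unit_spec]
      push_cast at this ⊢
      linear_combination -this
    · obtain ⟨y, hy⟩ := exists_int_modEq_five_pow (c := 3) (by norm_num) γ (-(u + 1))
      refine mem_connectionSet.mpr ⟨(hunit 3 y h3).unit, Or.inr ?_⟩
      have := (ZMod.intCast_zmod_eq_zero_iff_dvd _ n).mpr (hdvd'.trans (mul_dvd_mul_left 20 hy))
      rw [IsUnit.unit_spec]
      push_cast at this ⊢
      linear_combination this

end Periodic

/-! ### Prime factorization and the final classification. -/

theorem eq_two_pow_mul_pow_of_primes {n q : ℕ} (hn : n ≠ 0) (hq2 : q ≠ 2)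
    (h : ∀ p, p.Prime → p ∣ n → p = 2 ∨ p = q) :
    n = 2 ^ n.factorization 2 * q ^ n.factorization q := by
  conv_lhs => rw [← Nat.prod_factorization_pow_eq_self hn]
  rw [Finsupp.prod_of_support_subset (s := {2, q}) _ _ _ (by simp), Finset.prod_pair hq2.symm]
  intro p hp
  have := h p (Nat.prime_of_mem_primeFactors hp) (Nat.dvd_of_mem_primeFactors hp)
  simpa using this

end GroverWalk

theorem theorem4p8 (n : ℕ) [NeZero n] (hn : 2 ≤ n)
    [DecidableRel (GroverWalk.quadraticUnitaryCayleyGraph n).Adj] :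
    GroverWalk.IsPeriodic (GroverWalk.quadraticUnitaryCayleyGraph n) ↔
      (∃ α β : ℕ, α + β ≠ 0 ∧ n = 2 ^ α * 3 ^ β) ∨
      (∃ δ γ : ℕ, δ ≤ 2 ∧ 1 ≤ γ ∧ n = 2 ^ δ * 5 ^ γ) := by
  constructor
  · intro hper
    have hsmall : ∀ p, p.Prime → p ∣ n → p = 2 ∨ p = 3 ∨ p = 5 := by
      intro p hp hpn
      have h7 : p < 7 := by
        by_contra! h7
        exact GroverWalk.not_prime_dvd_of_isPeriodic hn hper hp h7 hpn
      interval_cases p <;> first | (exfalso; revert hp; norm_num; done) | simp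
    have h15 := GroverWalk.not_fifteen_dvd_of_isPeriodic hn hper
    have h40 := GroverWalk.not_forty_dvd_of_isPeriodic hn hper
    by_cases h5 : 5 ∣ n
    · right
      have h3 : ¬ 3 ∣ n := fun h3 => h15 (Nat.Coprime.mul_dvd_of_dvd_of_dvd (by norm_num) h3 h5)
      have h8 : ¬ 2 ^ 3 ∣ n := fun h8 => h40 (Nat.Coprime.mul_dvd_of_dvd_of_dvd (by norm_num) h8 h5)
      refine ⟨_, _, ?_, ?_, GroverWalk.eq_two_pow_mul_pow_of_primes (q := 5) (NeZero.ne n)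
        (by norm_num) fun p hp hpn => ?_⟩
      · by_contra! hlt
        exact h8 ((Nat.prime_two.pow_dvd_iff_le_factorization (NeZero.ne n)).mpr hlt)
      · exact (Nat.Prime.dvd_iff_one_le_factorization (by norm_num) (NeZero.ne n)).mp h5
      · rcases hsmall p hp hpn with rfl | rfl | rfl
        · exact Or.inl rfl
        · exact absurd hpn h3
        · exact Or.inr rfl
    · left
      have heq := GroverWalk.eq_two_pow_mul_pow_of_primes (q := 3) (NeZero.ne n)
        (by norm_num) fun p hp hpn => by
          rcases hsmall p hp hpn with rfl | rfl | rfl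
          · exact Or.inl rfl
          · exact Or.inr rfl
          · exact absurd hpn h5
      refine ⟨_, _, fun h0 => ?_, heq⟩
      rw [Nat.add_eq_zero_iff] at h0
      rw [h0.1, h0.2] at heq
      omega
  · rintro (⟨α, β, -, h⟩ | ⟨δ, γ, hδ, -, h⟩)
    · exact GroverWalk.isPeriodic_two_pow_mul_three_pow hn h
    · exact GroverWalk.isPeriodic_two_pow_mul_five_pow hn hδ h
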